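/- For an odd prime $p$ and an odd integer $d\ge 1$ with $p\equiv 1 \pmod{2d}$, let $\chi$ be a Dirichlet character modulo $p$ of order $(p-1)/d$ (such characters exist and are automatically odd), and put $$\mathcal A(p,d)=\frac1{p-1}\sum_{N=1}^{p-1}\#\{(n_1,n_2):1\le n_1,n_2\le N,\ \chi(n_1)=\chi(n_2)\},$$ which depends only on $p$ and $d$, not on the choice of $\chi$. For an odd integer $d\ge1$ put $\gamma(d)=\max_{k\mid d}\varphi(k)$, where $\varphi$ is Euler's totient function. **Theorem.** (i) For every odd $d>1$ we have $\gamma(d)\le d-1$, with equality whenever $d$ is an odd prime. (ii) There is an absolute constant $C>0$ such that for all odd $d\ge1$, all primes $p\equiv1\pmod{2d}$ and every such $\chi$, $$\left|\mathcal A(p,d)-\frac{2d+1}{6}\,p\right|\le C\,d\,(\log p)^2\,p^{\,1-1/\gamma(d)}.$$ (iii) Let $c<1/2$ be fixed. Then $\mathcal A(p,d)\sim\frac{2d+1}{6}\,p$ as $p\to\infty$, uniformly over odd $d\ge1$ with $p\equiv1\pmod{2d}$ and $d\le c\,\frac{\log p}{\log\log p}$: for every $\varepsilon>0$ there is $P$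 such that for all primes $p\ge P$ and all such $d$ and $\chi$, $\left|\mathcal A(p,d)\big/\left(\tfrac{2d+1}{6}p\right)-1\right|\le\varepsilon$. -/

import Mathlib

/-- The average `𝓐(p, d)` attached to a Dirichlet character `χ` modulo `p` of order `(p - 1) / d`:
`1 / (p - 1)` times the sum over `1 ≤ N ≤ p - 1` of the number of pairs `(n₁, n₂)` with
`1 ≤ n₁, n₂ ≤ N` and `χ n₁ = χ n₂`. -/
noncomputable def elmaSum (p : ℕ) (χ : DirichletCharacter ℂ p) : ℝ :=
  open Classical in
  1 / ((p : ℝ) - 1) *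
    ∑ N ∈ Finset.Icc 1 (p - 1),
      ((((Finset.Icc 1 N ×ˢ Finset.Icc 1 N).filter
        (fun n : ℕ × ℕ => χ (n.1 : ZMod p) = χ (n.2 : ZMod p))).card : ℕ) : ℝ)

/-- `γ(d)`, the maximum of `φ(k)` over the positive divisors `k` of `d ≥ 1`. -/
def maxTotient (d : ℕ) : ℕ := d.divisors.sup Nat.totient

/-!
Since `χ` has order `(p - 1) / d`, its kernel is the group of `d`-th roots of unity modulo `p`, and
`χ n₁ = χ n₂` means that `n₁ ≡ t n₂` for some `t` with `t ^ d = 1`. Hence the average is a sum over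
these `t` of `∑ n, (p - max (t n % p) n)`, divided by `p - 1` (`elmaSum_eq_sum_nthRoots`). The root
`t = 1` contributes exactly `p / 2`. For `t ≠ 1` write `a = t n % p` and `z = (t - 1) n % p`. Then
`p |a - n| = z (p - z) + (a - n) ^ 2`, and as `n` varies each of `a`, `z` runs through all residues.
So every term is explicit except `∑ n a`, a Dedekind sum `s(t, p)`, and `t` contributes
`p / 3 + 1 / 12 + p / (p - 1) * s(t, p)` (`elmaSum_sub_eq`).

It remains to see that `s(t, p)` is small. The reciprocity law (`dedekindSum_reciprocity`) reduces
it along Euclid's algorithm: it is bounded by the sum of the `O(log p)` quotients of consecutive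
remainders (`abs_dedekindSum_le_of_euclid`). Large quotients come from small points of the lattice
`a + b t ≡ 0` modulo `p`. If `t` has odd order `k > 1`, such a point makes `p` divide the norm of
`a + b ζ`, with `ζ` a primitive `k`-th root of unity, so `p ≤ (|a| + |b|) ^ φ k`
(`le_pow_totient_of_add_mul_eq_zero`); oddness is needed for the norm not to vanish. Therefore
every quotient is `O(p ^ (1 - 1 / γ(d)))`. The uniform asymptotic formula follows from `γ(d) ≤ d`.
-/

/-! ### Dedekind sums and reciprocity -/

/-- The Dedekind sum `s(h, k) = ∑ ((j / k)) ((h j / k))`, where `((x)) = x - ⌊x⌋ - 1/2` off the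
integers and `0` on them, in the expanded form that it takes for coprime `h` and `k ≥ 1`. It is
only used for such arguments. -/
noncomputable def dedekindSum (h k : ℕ) : ℝ :=
  ∑ j ∈ Finset.range k, (j : ℝ) * ((h * j % k : ℕ) : ℝ) / (k : ℝ) ^ 2 - ((k : ℝ) - 1) / 4

theorem dedekindSum_mod (h k : ℕ) : dedekindSum (h % k) k = dedekindSum h k := by
  simp [dedekindSum, Nat.mod_mul_mod]

theorem sum_range_mul_mod {M : Type*} [AddCommMonoid M] {h k : ℕ} (hk : 0 < k)
    (hc : Nat.Coprime h k) (f : ℕ → M) :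
    ∑ j ∈ Finset.range k, f (h * j % k) = ∑ j ∈ Finset.range k, f j := by
  have hinj : Set.InjOn (fun j => h * j % k) (Finset.range k : Set ℕ) := by
    intro a ha b hb hab
    have h1 : h * a ≡ h * b [MOD k] := hab
    have h2 := Nat.ModEq.cancel_left_of_coprime (by simpa [Nat.coprime_comm] using hc) h1
    exact Nat.ModEq.eq_of_lt_of_lt h2 (by simpa using ha) (by simpa using hb)
  have himg : (Finset.range k).image (fun j => h * j % k) = Finset.range k := by
    apply Finset.eq_of_subset_of_card_le
    · intro x hx
      obtain ⟨j, -, rfl⟩ := Finset.mem_image.1 hx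
      exact Finset.mem_range.2 (Nat.mod_lt _ hk)
    · rw [Finset.card_image_of_injOn hinj]
  rw [← Finset.sum_image (f := f) hinj, himg]

theorem sum_range_cast (n : ℕ) : ∑ j ∈ Finset.range n, (j : ℝ) = n * (n - 1) / 2 := by
  induction n with
  | zero => simp
  | succ n ih => rw [Finset.sum_range_succ, ih]; push_cast; ring

theorem sum_range_cast_sq (n : ℕ) :
    ∑ j ∈ Finset.range n, (j : ℝ) ^ 2 = n * (n - 1) * (2 * n - 1) / 6 := by
  induction n with
  | zero => simp
  | succ n ih => rw [Finset.sum_range_succ, ih]; push_cast; ring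

theorem cast_div_eq (a k : ℕ) (hk : 0 < k) :
    ((a / k : ℕ) : ℝ) = ((a : ℝ) - ((a % k : ℕ) : ℝ)) / k := by
  have h1 : ((k * (a / k) + a % k : ℕ) : ℝ) = a := by rw [Nat.div_add_mod]
  have hk' : (k : ℝ) ≠ 0 := by positivity
  push_cast at h1
  field_simp
  linarith

theorem card_mul_le (h k j : ℕ) (hk : 0 < k) (hj : j < k) :
    ((Finset.Ico 1 h).filter (fun i => i * k ≤ j * h)).card = h * j / k := by
  have : (Finset.Ico 1 h).filter (fun i => i * k ≤ j * h) = Finset.Ioc 0 (h * j / k) := by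
    ext i
    simp only [Finset.mem_filter, Finset.mem_Ico, Finset.mem_Ioc, Nat.le_div_iff_mul_le hk]
    constructor
    · rintro ⟨⟨h1, -⟩, h2⟩
      exact ⟨h1, by linarith⟩
    · rintro ⟨h1, h2⟩
      refine ⟨⟨h1, ?_⟩, by linarith⟩
      by_contra hcon
      push Not at hcon
      have : 0 < h ∨ h = 0 := by omega
      rcases this with h0 | h0
      · nlinarith
      · subst h0
        have : 0 < i * k := by positivity
        omega
  rw [this]
  simp

/-- Lattice points `(i, j)` in the rectangle `[1, h) × [0, k)` on or below its diagonal, weighted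
by `j` and counted by columns and by rows. -/
theorem sum_mul_div_eq {h k : ℕ} (hh : 0 < h) (hk : 0 < k) (hc : Nat.Coprime h k) :
    ∑ j ∈ Finset.range k, (j : ℝ) * ((h * j / k : ℕ) : ℝ) =
      ((h : ℝ) - 1) * (k * (k - 1) / 2) -
        ∑ i ∈ Finset.range h, (((k * i / h : ℕ) : ℝ) ^ 2 + ((k * i / h : ℕ) : ℝ)) / 2 := by
  have h1 : ∀ j ∈ Finset.range k, (j : ℝ) * ((h * j / k : ℕ) : ℝ) =
      ∑ i ∈ Finset.Ico 1 h, if i * k ≤ j * h then (j : ℝ) else 0 := by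
    intro j hj
    rw [← Finset.sum_filter, Finset.sum_const, card_mul_le h k j hk (Finset.mem_range.1 hj),
      nsmul_eq_mul, mul_comm]
  rw [Finset.sum_congr rfl h1, Finset.sum_comm]
  have h2 : ∀ i ∈ Finset.Ico 1 h, (∑ j ∈ Finset.range k, if i * k ≤ j * h then (j : ℝ) else 0) =
      (k : ℝ) * (k - 1) / 2 - (((k * i / h : ℕ) : ℝ) ^ 2 + ((k * i / h : ℕ) : ℝ)) / 2 := by
    intro i hi
    obtain ⟨hi1, hi2⟩ := Finset.mem_Ico.1 hi
    have h3 : (Finset.range k).filter (fun j => ¬ i * k ≤ j * h) =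
        Finset.range (k * i / h + 1) := by
      ext j
      simp only [Finset.mem_filter, Finset.mem_range, Nat.lt_succ_iff, Nat.le_div_iff_mul_le hh]
      constructor
      · rintro ⟨-, h4⟩
        linarith
      · intro h4
        have hjk : j < k := by
          by_contra hcon
          push Not at hcon
          nlinarith
        refine ⟨hjk, fun h5 => ?_⟩
        -- the diagonal contains no lattice point, by coprimality
        have h6 : k * i = j * h := by linarith
        have h7 : h ∣ i := hc.dvd_of_dvd_mul_left ⟨j, by linarith⟩
        exact absurd (Nat.le_of_dvd hi1 h7) (by omega)
    have h4 := Finset.sum_filter_add_sum_filter_not (Finset.range k)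
      (fun j => i * k ≤ j * h) (fun j => (j : ℝ))
    rw [h3, sum_range_cast, sum_range_cast] at h4
    rw [← Finset.sum_filter]
    push_cast at h4 ⊢
    linarith
  rw [Finset.sum_congr rfl h2, Finset.sum_sub_distrib]
  congr 1
  · simp [Nat.cast_sub (show 1 ≤ h by omega)]
  · rw [Finset.range_eq_Ico, Finset.sum_eq_sum_Ico_succ_bot hh]
    simp

theorem sum_mul_mod_eq {h k : ℕ} (hk : 0 < k) :
    ∑ j ∈ Finset.range k, (j : ℝ) * ((h * j % k : ℕ) : ℝ) =
      h * ∑ j ∈ Finset.range k, (j : ℝ) ^ 2 -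
        k * ∑ j ∈ Finset.range k, (j : ℝ) * ((h * j / k : ℕ) : ℝ) := by
  rw [Finset.mul_sum, Finset.mul_sum, ← Finset.sum_sub_distrib]
  refine Finset.sum_congr rfl fun j _ => ?_
  have hk' : (k : ℝ) ≠ 0 := by positivity
  rw [cast_div_eq _ _ hk]
  push_cast
  field_simp
  ring

theorem sum_div_eq {h k : ℕ} (hh : 0 < h) (hc : Nat.Coprime k h) :
    ∑ i ∈ Finset.range h, ((k * i / h : ℕ) : ℝ) = ((k : ℝ) - 1) * (h - 1) / 2 := by
  have hh' : (h : ℝ) ≠ 0 := by positivity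
  have h1 : ∀ i ∈ Finset.range h, ((k * i / h : ℕ) : ℝ) =
      (k / h) * (i : ℝ) - (1 / h) * ((k * i % h : ℕ) : ℝ) := by
    intro i _
    rw [cast_div_eq _ _ hh]
    push_cast
    field_simp
  rw [Finset.sum_congr rfl h1, Finset.sum_sub_distrib, ← Finset.mul_sum, ← Finset.mul_sum,
    sum_range_mul_mod hh hc (fun i => (i : ℝ)), sum_range_cast]
  field_simp

theorem sum_div_sq_eq {h k : ℕ} (hh : 0 < h) (hc : Nat.Coprime k h) :
    ∑ i ∈ Finset.range h, ((k * i / h : ℕ) : ℝ) ^ 2 =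
      ((k : ℝ) ^ 2 + 1) / (h : ℝ) ^ 2 * ∑ i ∈ Finset.range h, (i : ℝ) ^ 2 -
        2 * k / (h : ℝ) ^ 2 * ∑ i ∈ Finset.range h, (i : ℝ) * ((k * i % h : ℕ) : ℝ) := by
  have hh' : (h : ℝ) ≠ 0 := by positivity
  have h1 : ∀ i ∈ Finset.range h, ((k * i / h : ℕ) : ℝ) ^ 2 =
      (k : ℝ) ^ 2 / (h : ℝ) ^ 2 * (i : ℝ) ^ 2 + 1 / (h : ℝ) ^ 2 * ((k * i % h : ℕ) : ℝ) ^ 2 -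
        2 * k / (h : ℝ) ^ 2 * ((i : ℝ) * ((k * i % h : ℕ) : ℝ)) := by
    intro i _
    rw [cast_div_eq _ _ hh]
    push_cast
    field_simp
    ring
  rw [Finset.sum_congr rfl h1, Finset.sum_sub_distrib, Finset.sum_add_distrib, ← Finset.mul_sum,
    ← Finset.mul_sum, ← Finset.mul_sum, sum_range_mul_mod hh hc (fun i => (i : ℝ) ^ 2)]
  ring

/-- Dedekind's reciprocity law. -/
theorem dedekindSum_reciprocity {h k : ℕ} (hh : 0 < h) (hk : 0 < k) (hc : Nat.Coprime h k) :
    dedekindSum h k + dedekindSum k h =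
      (-3 + (h : ℝ) / k + (k : ℝ) / h + 1 / (h * k)) / 12 := by
  have hh' : (h : ℝ) ≠ 0 := by positivity
  have hk' : (k : ℝ) ≠ 0 := by positivity
  have e1 := sum_mul_mod_eq (h := h) hk
  have e2 := sum_mul_div_eq hh hk hc
  rw [← Finset.sum_div, Finset.sum_add_distrib, sum_div_eq hh hc.symm,
    sum_div_sq_eq hh hc.symm] at e2
  rw [e2] at e1
  unfold dedekindSum
  rw [← Finset.sum_div, ← Finset.sum_div, e1]
  rw [sum_range_cast_sq, sum_range_cast_sq]
  field_simp
  ring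

theorem abs_dedekindSum_add_le {h k : ℕ} (hh : 0 < h) (hhk : h ≤ k) (hc : Nat.Coprime h k) :
    |dedekindSum h k + dedekindSum k h| ≤ (k : ℝ) / h := by
  have hk : 0 < k := by omega
  have hh1 : (1 : ℝ) ≤ h := by exact_mod_cast hh
  have hk1 : (1 : ℝ) ≤ k := by exact_mod_cast hk
  have hhk' : (h : ℝ) ≤ k := by exact_mod_cast hhk
  rw [dedekindSum_reciprocity hh hk hc]
  have a1 : (h : ℝ) / k ≤ 1 := (div_le_one (by linarith)).2 hhk'
  have a2 : 1 ≤ (k : ℝ) / h := (one_le_div (by linarith)).2 hhk'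
  have a3 : 1 / ((h : ℝ) * k) ≤ 1 := by
    rw [div_le_one (by positivity)]
    nlinarith
  have a4 : 0 ≤ (h : ℝ) / k := by positivity
  have a5 : 0 ≤ 1 / ((h : ℝ) * k) := by positivity
  rw [abs_le]
  constructor <;> linarith

/-! ### Euclid's algorithm and the size of a Dedekind sum -/

/-- One run of Euclid's algorithm on `(k, r)`, where `k` and `r` are consecutive remainders of the
algorithm for `p` and `h`, and `u`, `v` the absolute values of the cofactors of `h` belonging to
them. Each step contributes about `k / r`, which is `O(p / R)` because `(r, ±v)` is a point of the
lattice `a + b h ≡ 0 [ZMOD p]`, and the product `k r` is at least halved. -/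
theorem abs_dedekindSum_le_of_euclid {p h : ℕ} {R : ℝ} (hR : 0 < R)
    (hlat : ∀ a b : ℤ, b ≠ 0 → (a + b * h : ZMod p) = 0 → R ≤ |(a : ℝ)| + |(b : ℝ)|) (n : ℕ) :
    ∀ k r u v : ℕ, k * r < 2 ^ n → 0 < k → r ≤ k → Nat.Coprime r k → k * v + r * u = p → 0 < v →
      ((r : ZMod p) = h * v ∧ (k : ZMod p) = -(h * u) ∨
        (r : ZMod p) = -(h * v) ∧ (k : ZMod p) = h * u) →
      |dedekindSum r k| ≤ n * (2 * p / R) := by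
  induction n with
  | zero =>
    intro k r u v hkr hk hrk hc hp hv hz
    have h0 : r = 0 := by
      rcases Nat.eq_zero_or_pos r with h | h
      · exact h
      · have := Nat.mul_pos hk h
        omega
    subst h0
    have h1 : k = 1 := by simpa using hc
    subst h1
    simp [dedekindSum]
  | succ n ih =>
    intro k r u v hkr hk hrk hc hp hv hz
    have hpR : 0 ≤ 2 * (p : ℝ) / R := by positivity
    rcases Nat.eq_zero_or_pos r with h0 | hr
    · subst h0
      have h1 : k = 1 := by simpa using hc
      subst h1
      simp only [dedekindSum]
      simp
      positivity
    have hdm := Nat.div_add_mod k r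
    have hq : 0 < k / r := Nat.div_pos hrk hr
    have hmod : k % r < r := Nat.mod_lt _ hr
    have hrec : |dedekindSum (k % r) r| ≤ n * (2 * p / R) := by
      refine ih r (k % r) v (u + k / r * v) ?_ hr hmod.le ?_ ?_ ?_ ?_
      · rw [pow_succ] at hkr
        have : k % r + k % r ≤ k := by nlinarith
        nlinarith
      · rw [Nat.Coprime, ← Nat.gcd_rec]
        exact hc
      · nlinarith
      · have := Nat.mul_pos hq hv
        omega
      · have hz' : (k : ZMod p) = r * ((k / r : ℕ) : ZMod p) + ((k % r : ℕ) : ZMod p) := by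
          exact_mod_cast congrArg (Nat.cast (R := ZMod p)) hdm.symm
        push_cast
        rcases hz with ⟨hz1, hz2⟩ | ⟨hz1, hz2⟩
        · right
          refine ⟨?_, hz1⟩
          linear_combination hz2 - hz' - ((k / r : ℕ) : ZMod p) * hz1
        · left
          refine ⟨?_, hz1⟩
          linear_combination hz2 - hz' - ((k / r : ℕ) : ZMod p) * hz1
    have hlow : R ≤ (r : ℝ) + v := by
      rcases hz with ⟨hz1, -⟩ | ⟨hz1, -⟩
      · have := hlat r (-v) (by omega) (by push_cast; rw [hz1]; ring)
        simpa using this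
      · have := hlat r v (by omega) (by push_cast; rw [hz1]; ring)
        simpa using this
    have hstep : (k : ℝ) / r ≤ 2 * p / R := by
      have hr1 : (1 : ℝ) ≤ r := by exact_mod_cast hr
      have hv1 : (1 : ℝ) ≤ v := by exact_mod_cast hv
      have hk1 : (1 : ℝ) ≤ k := by exact_mod_cast hk
      have hkv : (k : ℝ) * v ≤ p := by exact_mod_cast (by omega : k * v ≤ p)
      rw [div_le_div_iff₀ (by linarith) hR]
      have h1 : (k : ℝ) * R ≤ k * (r + v) := by gcongr
      nlinarith [mul_nonneg (show (0 : ℝ) ≤ p - k by nlinarith) (show (0 : ℝ) ≤ r by linarith),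
        mul_nonneg (show (0 : ℝ) ≤ p - k * v by linarith) (show (0 : ℝ) ≤ r - 1 by linarith)]
    have hrep := abs_dedekindSum_add_le hr hrk hc
    rw [← dedekindSum_mod k r] at hrep
    have htri : |dedekindSum r k| ≤
        |dedekindSum r k + dedekindSum (k % r) r| + |dedekindSum (k % r) r| := by
      have := abs_sub (dedekindSum r k + dedekindSum (k % r) r) (dedekindSum (k % r) r)
      simpa using this
    push_cast
    linarith

theorem one_le_log_natCast {p : ℕ} (hp : 3 ≤ p) : 1 ≤ Real.log p := by
  have hp' : (3 : ℝ) ≤ p := by exact_mod_cast hp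
  rw [Real.le_log_iff_exp_le (by linarith)]
  linarith [Real.exp_one_lt_d9]

theorem abs_dedekindSum_le {p h : ℕ} {R : ℝ} (hR : 0 < R) (hp : 3 ≤ p) (hhp : h < p)
    (hc : Nat.Coprime h p)
    (hlat : ∀ a b : ℤ, b ≠ 0 → (a + b * h : ZMod p) = 0 → R ≤ |(a : ℝ)| + |(b : ℝ)|) :
    |dedekindSum h p| ≤ 10 * Real.log p * (p / R) := by
  have h1 := abs_dedekindSum_le_of_euclid hR hlat (2 * (Nat.log 2 p + 1)) p h 0 1 (by
      have h2 : p < 2 ^ (Nat.log 2 p + 1) := Nat.lt_pow_succ_log_self (by norm_num) p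
      rw [two_mul, pow_add]
      exact Nat.mul_lt_mul'' h2 (hhp.trans h2)) (by omega) hhp.le hc (by simp) one_pos (by simp)
  refine h1.trans ?_
  have hlog := one_le_log_natCast hp
  have h3 : (Nat.log 2 p : ℝ) * Real.log 2 ≤ Real.log p := by
    rw [← Real.log_pow]
    apply Real.log_le_log (by positivity)
    exact_mod_cast Nat.pow_log_le_self 2 (by omega)
  have h4 : (Nat.log 2 p : ℝ) + 1 ≤ 5 / 2 * Real.log p := by
    nlinarith [Real.log_two_gt_d9, (Nat.cast_nonneg (Nat.log 2 p) : (0 : ℝ) ≤ _)]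
  have h5 : 0 ≤ (p : ℝ) / R := by positivity
  have h6 : ((2 * (Nat.log 2 p + 1) : ℕ) : ℝ) * (2 * p / R) =
      4 * ((Nat.log 2 p : ℝ) + 1) * (p / R) := by
    push_cast
    ring
  rw [h6]
  apply mul_le_mul_of_nonneg_right _ h5
  linarith

/-! ### Small solutions of a linear congruence -/

theorem intCast_add_mul_ne_zero {k : ℕ} (hk : Odd k) (hk1 : 1 < k) {ζ : ℂ}
    (hζ : IsPrimitiveRoot ζ k) {a b : ℤ} (hb : b ≠ 0) : (a + b * ζ : ℂ) ≠ 0 := by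
  intro h0
  have hb' : (b : ℂ) ≠ 0 := by exact_mod_cast hb
  have hζeq : ζ = ((-a / b : ℝ) : ℂ) := by
    push_cast
    field_simp
    linear_combination h0
  have hpow : ((-a / b : ℝ)) ^ k = 1 := by
    have := hζ.pow_eq_one
    rw [hζeq] at this
    exact_mod_cast this
  -- a real root of unity of odd order is `1`
  have h1 : (-a / b : ℝ) = 1 := hk.strictMono_pow.injective (by simpa using hpow)
  rw [h1] at hζeq
  exact hζ.ne_one hk1 (by simpa using hζeq)

/-- If `t` has odd order `k > 1` modulo `p`, then `a + b t ≡ 0` forces `p` to divide the norm of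
`a + b ζ` from the `k`-th cyclotomic field. That norm is a nonzero integer, of absolute value at
most `(|a| + |b|) ^ φ k`. -/
theorem le_pow_totient_of_add_mul_eq_zero {p k : ℕ} [Fact p.Prime] (hk : Odd k) (hk1 : 1 < k)
    {t : ZMod p} (ht : IsPrimitiveRoot t k) {a b : ℤ} (hb : b ≠ 0) (hab : a + b * t = 0) :
    (p : ℝ) ≤ (|(a : ℝ)| + |(b : ℝ)|) ^ k.totient := by
  -- the norm, as a value of the homogenized cyclotomic polynomial
  set N : ℤ := ((Polynomial.cyclotomic k ℤ).scaleRoots b).eval (-a) with hN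
  have hkpos : 0 < k := by omega
  have hdvd : (p : ℤ) ∣ N := by
    rw [← ZMod.intCast_zmod_eq_zero_iff_dvd]
    have hroot : (Polynomial.cyclotomic k ℤ).eval₂ (Int.castRingHom (ZMod p)) t = 0 := by
      rw [Polynomial.eval₂_eq_eval_map, Polynomial.map_cyclotomic_int]
      exact ht.isRoot_cyclotomic hkpos
    have h2 := Polynomial.scaleRoots_eval₂_eq_zero (Int.castRingHom (ZMod p)) (s := b) hroot
    have h3 : (Int.castRingHom (ZMod p)) b * t = (Int.castRingHom (ZMod p)) (-a) := by
      simp only [eq_intCast, Int.cast_neg]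
      linear_combination hab
    rw [h3, Polynomial.eval₂_hom] at h2
    simpa using h2
  have hprod : (N : ℂ) = ∏ ζ ∈ primitiveRoots k ℂ, (-a - b * ζ : ℂ) := by
    have hb' : (b : ℂ) ≠ 0 := by exact_mod_cast hb
    have h1 := Polynomial.scaleRoots_eval₂_mul (p := Polynomial.cyclotomic k ℤ)
      (Int.castRingHom ℂ) (-a / b : ℂ) b
    have h2 : (Int.castRingHom ℂ) b * (-a / b : ℂ) = (Int.castRingHom ℂ) (-a) := by
      simp only [eq_intCast, Int.cast_neg]
      field_simp
    rw [h2, Polynomial.eval₂_hom, Polynomial.natDegree_cyclotomic, Polynomial.eval₂_eq_eval_map,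
      Polynomial.map_cyclotomic_int,
      Polynomial.cyclotomic_eq_prod_X_sub_primitiveRoots
        (Complex.isPrimitiveRoot_exp k hkpos.ne'), Polynomial.eval_prod] at h1
    rw [eq_intCast] at h1
    rw [hN, h1, eq_intCast, ← (Complex.isPrimitiveRoot_exp k hkpos.ne').card_primitiveRoots,
      ← Finset.prod_const, ← Finset.prod_mul_distrib]
    refine Finset.prod_congr rfl fun ζ _ => ?_
    simp
    field_simp
  have hN0 : N ≠ 0 := by
    intro h0
    rw [h0, Int.cast_zero, eq_comm, Finset.prod_eq_zero_iff] at hprod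
    obtain ⟨ζ, hζ, h1⟩ := hprod
    exact intCast_add_mul_ne_zero hk hk1 (isPrimitiveRoot_of_mem_primitiveRoots hζ) hb
      (by linear_combination -h1 : (a + b * ζ : ℂ) = 0)
  have hle : (p : ℝ) ≤ |(N : ℝ)| := by
    have := Int.le_of_dvd (abs_pos.2 hN0) ((dvd_abs _ _).2 hdvd)
    exact_mod_cast this
  refine hle.trans ?_
  have hnorm : |(N : ℝ)| = ‖(N : ℂ)‖ := by simp
  rw [hnorm, hprod, norm_prod,
    ← (Complex.isPrimitiveRoot_exp k hkpos.ne').card_primitiveRoots, ← Finset.prod_const]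
  refine Finset.prod_le_prod (fun _ _ => norm_nonneg _) fun ζ hζ => ?_
  have hζ1 : ‖ζ‖ = 1 :=
    (isPrimitiveRoot_of_mem_primitiveRoots hζ).norm'_eq_one hkpos.ne'
  calc ‖(-a - b * ζ : ℂ)‖ ≤ ‖(-a : ℂ)‖ + ‖(b * ζ : ℂ)‖ := norm_sub_le _ _
    _ = |(a : ℝ)| + |(b : ℝ)| := by simp [hζ1]

/-! ### Counting pairs with equal character values -/

theorem sum_card_filter_prod (p : ℕ) (P : ℕ × ℕ → Prop) [DecidablePred P] :
    ∑ N ∈ Finset.Icc 1 (p - 1),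
        ((((Finset.Icc 1 N ×ˢ Finset.Icc 1 N).filter P).card : ℕ) : ℝ) =
      ∑ n ∈ Finset.Icc 1 (p - 1), ∑ m ∈ (Finset.Icc 1 (p - 1)).filter (fun m => P (m, n)),
        ((p : ℝ) - max (m : ℝ) n) := by
  have h1 : ∀ N ∈ Finset.Icc 1 (p - 1),
      ((((Finset.Icc 1 N ×ˢ Finset.Icc 1 N).filter P).card : ℕ) : ℝ) =
        ∑ n ∈ Finset.Icc 1 (p - 1), ∑ m ∈ (Finset.Icc 1 (p - 1)).filter (fun m => P (m, n)),
          if max m n ≤ N then (1 : ℝ) else 0 := by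
    intro N hN
    have h2 : (Finset.Icc 1 N ×ˢ Finset.Icc 1 N).filter P =
        (Finset.Icc 1 (p - 1) ×ˢ Finset.Icc 1 (p - 1)).filter
          (fun x => P x ∧ max x.1 x.2 ≤ N) := by
      ext ⟨m, n⟩
      simp only [Finset.mem_filter, Finset.mem_product, Finset.mem_Icc, max_le_iff] at hN ⊢
      constructor
      · rintro ⟨⟨⟨h1, h2⟩, h3, h4⟩, h5⟩
        exact ⟨⟨⟨h1, by omega⟩, h3, by omega⟩, h5, h2, h4⟩
      · rintro ⟨⟨⟨h1, h2⟩, h3, h4⟩, h5, h6, h7⟩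
        exact ⟨⟨⟨h1, h6⟩, h3, h7⟩, h5⟩
    rw [h2, ← Finset.filter_filter, Finset.card_filter, Nat.cast_sum, Finset.sum_filter,
      Finset.sum_product_right]
    refine Finset.sum_congr rfl fun n _ => ?_
    rw [Finset.sum_filter]
    refine Finset.sum_congr rfl fun m _ => ?_
    simp
  rw [Finset.sum_congr rfl h1, Finset.sum_comm]
  refine Finset.sum_congr rfl fun n hn => ?_
  rw [Finset.sum_comm]
  refine Finset.sum_congr rfl fun m hm => ?_
  have hm' := (Finset.mem_filter.1 hm).1
  rw [Finset.mem_Icc] at hn hm'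
  rw [← Finset.sum_filter, Finset.sum_const, nsmul_eq_mul, mul_one]
  have h3 : (Finset.Icc 1 (p - 1)).filter (fun N => max m n ≤ N) =
      Finset.Icc (max m n) (p - 1) := by
    ext N
    simp only [Finset.mem_filter, Finset.mem_Icc, max_le_iff]
    omega
  rw [h3, Nat.card_Icc, show p - 1 + 1 = p by omega, Nat.cast_sub (by omega), Nat.cast_max]

theorem apply_unit_eq_one_iff {p d : ℕ} [Fact p.Prime] (hd : 0 < d) (hdp : d ∣ p - 1)
    {χ : DirichletCharacter ℂ p} (hχ : orderOf χ = (p - 1) / d) (u : (ZMod p)ˣ) :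
    χ (u : ZMod p) = 1 ↔ u ^ d = 1 := by
  obtain ⟨g, hg⟩ := IsCyclic.exists_generator (α := (ZMod p)ˣ)
  have hordg : orderOf g = p - 1 := by
    rw [orderOf_eq_card_of_forall_mem_zpowers hg, Nat.card_eq_fintype_card, ZMod.card_units]
  have hord : orderOf (χ (g : ZMod p)) = (p - 1) / d := by
    rw [← hχ]
    refine orderOf_eq_orderOf_iff.2 fun n => ?_
    rw [MulChar.eq_iff hg, MulChar.pow_apply_coe, MulChar.one_apply_coe]
  obtain ⟨j, rfl⟩ : ∃ j : ℕ, g ^ j = u := (mem_powers_iff_mem_zpowers.2 (hg u))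
  rw [Units.val_pow_eq_pow_val, map_pow, ← orderOf_dvd_iff_pow_eq_one, hord, ← pow_mul,
    ← orderOf_dvd_iff_pow_eq_one, hordg, ← Nat.mul_dvd_mul_iff_right hd,
    Nat.div_mul_cancel hdp]

theorem apply_eq_apply_iff {p d : ℕ} [Fact p.Prime] (hd : 0 < d) (hdp : d ∣ p - 1)
    {χ : DirichletCharacter ℂ p} (hχ : orderOf χ = (p - 1) / d) {x y : ZMod p} (hx : x ≠ 0)
    (hy : y ≠ 0) : χ x = χ y ↔ (x / y) ^ d = 1 := by
  have hy' : χ y ≠ 0 := by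
    have := (IsUnit.mk0 y hy).map χ
    exact this.ne_zero
  have hxy : x / y ≠ 0 := div_ne_zero hx hy
  have h1 := apply_unit_eq_one_iff hd hdp hχ (Units.mk0 _ hxy)
  rw [Units.ext_iff] at h1
  simp only [Units.val_mk0, Units.val_pow_eq_pow_val, Units.val_one] at h1
  rw [← h1]
  have h2 : χ x = χ (x / y) * χ y := by rw [← map_mul, div_mul_cancel₀ _ hy]
  rw [h2]
  exact mul_eq_right₀ hy'

theorem natCast_zmod_ne_zero {p n : ℕ} (h1 : 1 ≤ n) (h2 : n ≤ p - 1) : (n : ZMod p) ≠ 0 := by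
  rw [Ne, ZMod.natCast_eq_zero_iff]
  intro h
  have := Nat.le_of_dvd h1 h
  omega

/-- The average as a sum over the kernel of `χ`, the group of `d`-th roots of unity modulo `p`:
the pairs with `χ n₁ = χ n₂` are the pairs `(t n % p, n)` with `t ^ d = 1`. -/
theorem elmaSum_eq_sum_nthRoots {p d : ℕ} [Fact p.Prime] (hd : 0 < d) (hdp : d ∣ p - 1)
    {χ : DirichletCharacter ℂ p} (hχ : orderOf χ = (p - 1) / d) :
    elmaSum p χ = 1 / ((p : ℝ) - 1) * ∑ t ∈ Polynomial.nthRootsFinset d (1 : ZMod p),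
      ∑ n ∈ Finset.Icc 1 (p - 1), ((p : ℝ) - max ((t.val * n % p : ℕ) : ℝ) n) := by
  classical
  have hp : 0 < p := (Fact.out : p.Prime).pos
  unfold elmaSum
  rw [sum_card_filter_prod, Finset.sum_comm]
  congr 1
  refine Finset.sum_congr rfl fun n hn => ?_
  obtain ⟨hn1, hn2⟩ := Finset.mem_Icc.1 hn
  have hn0 : (n : ZMod p) ≠ 0 := natCast_zmod_ne_zero hn1 hn2
  symm
  have hcast : ∀ t : ZMod p, ((t.val * n % p : ℕ) : ZMod p) = t * n := by
    intro t
    rw [ZMod.natCast_mod, Nat.cast_mul, ZMod.natCast_zmod_val]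
  refine Finset.sum_bij (fun t _ => t.val * n % p) ?_ ?_ ?_ ?_
  · intro t ht
    rw [Polynomial.mem_nthRootsFinset hd] at ht
    have ht0 : t ≠ 0 := by
      rintro rfl
      simp [hd.ne'] at ht
    have hne : ((t.val * n % p : ℕ) : ZMod p) ≠ 0 := by
      rw [hcast]
      exact mul_ne_zero ht0 hn0
    have hpos : t.val * n % p ≠ 0 := by
      intro h
      rw [h] at hne
      simp at hne
    have hlt := Nat.mod_lt (t.val * n) hp
    rw [Finset.mem_filter, Finset.mem_Icc]
    refine ⟨by omega, ?_⟩
    rw [apply_eq_apply_iff hd hdp hχ hne hn0, hcast, mul_div_cancel_right₀ _ hn0, ht]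
  · intro t _ t' _ h
    have h1 := congrArg (Nat.cast (R := ZMod p)) h
    simp only [hcast] at h1
    exact mul_right_cancel₀ hn0 h1
  · intro m hm
    obtain ⟨hm1, hm2⟩ := Finset.mem_filter.1 hm
    rw [Finset.mem_Icc] at hm1
    have hm0 : (m : ZMod p) ≠ 0 := natCast_zmod_ne_zero hm1.1 hm1.2
    refine ⟨m / n, ?_, ?_⟩
    · rw [Polynomial.mem_nthRootsFinset hd]
      exact (apply_eq_apply_iff hd hdp hχ hm0 hn0).1 hm2
    · have h1 := hcast (m / n)
      rw [div_mul_cancel₀ _ hn0, ZMod.natCast_eq_natCast_iff] at h1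
      exact h1.eq_of_lt_of_lt (Nat.mod_lt _ hp) (by omega)
  · intro t _
    rfl

theorem card_nthRootsFinset_zmod {p d : ℕ} [Fact p.Prime] (hdp : d ∣ p - 1) :
    (Polynomial.nthRootsFinset d (1 : ZMod p)).card = d := by
  obtain ⟨g, hg⟩ := IsCyclic.exists_generator (α := (ZMod p)ˣ)
  have hordg : orderOf g = p - 1 := by
    rw [orderOf_eq_card_of_forall_mem_zpowers hg, Nat.card_eq_fintype_card, ZMod.card_units]
  have hp : 0 < p - 1 := by
    have := (Fact.out : p.Prime).two_le
    omega
  have h1 : IsPrimitiveRoot (g : ZMod p) (p - 1) := by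
    rw [IsPrimitiveRoot.coe_units_iff, ← hordg]
    exact IsPrimitiveRoot.orderOf g
  exact (h1.pow hp (Nat.div_mul_cancel hdp).symm).card_nthRootsFinset

/-! ### The contribution of one root of unity -/

theorem sum_Icc_max_eq {p t : ℕ} (hp : 0 < p) (hc : Nat.Coprime t p) :
    ∑ n ∈ Finset.Icc 1 (p - 1), ((p : ℝ) - max ((t * n % p : ℕ) : ℝ) n) =
      (p : ℝ) * (p - 1) / 2 -
        1 / 2 * ∑ n ∈ Finset.range p, |((t * n % p : ℕ) : ℝ) - n| := by
  have h1 : ∑ n ∈ Finset.range p, ((p : ℝ) - max ((t * n % p : ℕ) : ℝ) n) =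
      ∑ n ∈ Finset.range p, ((p : ℝ) - 1 / 2 * ((t * n % p : ℕ) : ℝ) - 1 / 2 * n -
        1 / 2 * |((t * n % p : ℕ) : ℝ) - n|) := by
    refine Finset.sum_congr rfl fun n _ => ?_
    rcases le_total ((t * n % p : ℕ) : ℝ) n with h | h
    · rw [max_eq_right h, abs_of_nonpos (by linarith)]
      ring
    · rw [max_eq_left h, abs_of_nonneg (by linarith)]
      ring
  have h0 : ∑ n ∈ Finset.range p, ((p : ℝ) - 1 / 2 * ((t * n % p : ℕ) : ℝ) - 1 / 2 * n -
        1 / 2 * |((t * n % p : ℕ) : ℝ) - n|) = p * p - p * (p - 1) / 2 -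
        1 / 2 * ∑ n ∈ Finset.range p, |((t * n % p : ℕ) : ℝ) - n| := by
    rw [Finset.sum_sub_distrib, Finset.sum_sub_distrib, Finset.sum_sub_distrib,
      ← Finset.mul_sum, ← Finset.mul_sum, ← Finset.mul_sum,
      sum_range_mul_mod hp hc (fun n => (n : ℝ)), sum_range_cast, Finset.sum_const,
      Finset.card_range, nsmul_eq_mul]
    ring
  rw [h0] at h1
  have h2 : Finset.Icc 1 (p - 1) = Finset.Ico 1 p := by
    ext
    simp only [Finset.mem_Icc, Finset.mem_Ico]
    omega
  rw [Finset.range_eq_Ico, Finset.sum_eq_sum_Ico_succ_bot hp, ← Finset.range_eq_Ico] at h1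
  rw [h2]
  simp only [mul_zero, Nat.zero_mod, Nat.cast_zero, max_self, zero_add, sub_zero] at h1
  linarith

/-- With `a = t n % p` and `z = (t - 1) n % p`, the difference `a - n` is `z` or `z - p`. -/
theorem mul_abs_mod_sub_eq {p t n : ℕ} (ht : 1 ≤ t) (hn : n < p) :
    (p : ℝ) * |((t * n % p : ℕ) : ℝ) - n| =
      ((t - 1) * n % p : ℕ) * (p - ((t - 1) * n % p : ℕ)) +
        (((t * n % p : ℕ) : ℝ) - n) ^ 2 := by
  have hp : 0 < p := by omega
  have ha := Nat.mod_lt (t * n) hp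
  have hz := Nat.mod_lt ((t - 1) * n) hp
  have hcong : ((t - 1) * n % p + n) ≡ t * n % p [MOD p] := by
    have h1 : (t - 1) * n + n = t * n := by
      obtain ⟨s, rfl⟩ : ∃ s, t = s + 1 := ⟨t - 1, by omega⟩
      rw [Nat.add_sub_cancel]
      ring
    calc (t - 1) * n % p + n ≡ (t - 1) * n + n [MOD p] :=
          (Nat.mod_modEq _ _).add_right n
      _ = t * n := h1
      _ ≡ t * n % p [MOD p] := (Nat.mod_modEq _ _).symm
  generalize (t - 1) * n % p = z at *
  generalize t * n % p = a at *
  have hcases : a = z + n ∨ a + p = z + n := by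
    rcases Nat.lt_or_ge (z + n) p with h | h
    · exact Or.inl (hcong.eq_of_lt_of_lt h ha).symm
    · right
      have h2 : z + n - p ≡ a [MOD p] := by
        have h3 : z + n - p + p ≡ a + p [MOD p] := by
          rw [Nat.sub_add_cancel h]
          exact hcong.trans (by simp [Nat.ModEq])
        exact Nat.ModEq.add_right_cancel' p h3
      have := h2.eq_of_lt_of_lt (by omega) ha
      omega
  have hz' : (z : ℝ) ≤ p := by exact_mod_cast hz.le
  rcases hcases with h | h
  · have h' : (a : ℝ) = z + n := by exact_mod_cast h
    rw [h', add_sub_cancel_right, abs_of_nonneg (Nat.cast_nonneg z)]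
    ring
  · have h' : (a : ℝ) - n = z - p := by
      have : (a : ℝ) + p = z + n := by exact_mod_cast h
      linarith
    rw [h', abs_of_nonpos (by linarith)]
    ring

theorem sum_abs_mod_sub_eq {p t : ℕ} (hp : 0 < p) (ht : 1 ≤ t) (hc : Nat.Coprime t p)
    (hc' : Nat.Coprime (t - 1) p) :
    ∑ n ∈ Finset.range p, |((t * n % p : ℕ) : ℝ) - n| =
      ((p : ℝ) - 1) * (2 * p - 1) / 6 - 2 * p * dedekindSum t p := by
  have hp' : (p : ℝ) ≠ 0 := by positivity
  apply mul_left_cancel₀ hp'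
  rw [Finset.mul_sum]
  have h1 : ∀ n ∈ Finset.range p, (p : ℝ) * |((t * n % p : ℕ) : ℝ) - n| =
      p * (((t - 1) * n % p : ℕ) : ℝ) - (((t - 1) * n % p : ℕ) : ℝ) ^ 2 +
        ((t * n % p : ℕ) : ℝ) ^ 2 + (n : ℝ) ^ 2 - 2 * ((n : ℝ) * ((t * n % p : ℕ) : ℝ)) := by
    intro n hn
    rw [mul_abs_mod_sub_eq ht (Finset.mem_range.1 hn)]
    ring
  rw [Finset.sum_congr rfl h1, Finset.sum_sub_distrib, Finset.sum_add_distrib,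
    Finset.sum_add_distrib, Finset.sum_sub_distrib, ← Finset.mul_sum, ← Finset.mul_sum,
    sum_range_mul_mod hp hc' (fun n => (n : ℝ)), sum_range_mul_mod hp hc' (fun n => (n : ℝ) ^ 2),
    sum_range_mul_mod hp hc (fun n => (n : ℝ) ^ 2), sum_range_cast, sum_range_cast_sq,
    dedekindSum, ← Finset.sum_div]
  field_simp
  ring

theorem sum_Icc_max_eq_dedekindSum {p t : ℕ} (hp : 0 < p) (ht : 1 ≤ t) (hc : Nat.Coprime t p)
    (hc' : Nat.Coprime (t - 1) p) :
    ∑ n ∈ Finset.Icc 1 (p - 1), ((p : ℝ) - max ((t * n % p : ℕ) : ℝ) n) =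
      ((p : ℝ) - 1) * (p / 3 + 1 / 12) + p * dedekindSum t p := by
  rw [sum_Icc_max_eq hp hc, sum_abs_mod_sub_eq hp ht hc hc']
  ring

theorem sum_Icc_max_one {p : ℕ} (hp : 0 < p) :
    ∑ n ∈ Finset.Icc 1 (p - 1), ((p : ℝ) - max ((1 * n % p : ℕ) : ℝ) n) =
      ((p : ℝ) - 1) * (p / 2) := by
  rw [sum_Icc_max_eq hp (Nat.coprime_one_left p), Finset.sum_eq_zero]
  · ring
  · intro n hn
    rw [one_mul, Nat.mod_eq_of_lt (Finset.mem_range.1 hn)]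
    simp

/-- The deviation from the main term is, up to a bounded amount for each root of unity `t ≠ 1`,
a sum of Dedekind sums. -/
theorem elmaSum_sub_eq {p d : ℕ} [Fact p.Prime] (hd : 0 < d) (hdp : d ∣ p - 1)
    {χ : DirichletCharacter ℂ p} (hχ : orderOf χ = (p - 1) / d) :
    elmaSum p χ - (2 * (d : ℝ) + 1) / 6 * p =
      ∑ t ∈ (Polynomial.nthRootsFinset d (1 : ZMod p)).erase 1,
        (1 / 12 + p / ((p : ℝ) - 1) * dedekindSum t.val p) := by
  have hprime : p.Prime := Fact.out
  have hp1 : (0 : ℝ) < p - 1 := by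
    have : (1 : ℝ) < p := by exact_mod_cast hprime.one_lt
    linarith
  have : Fact (1 < p) := ⟨hprime.one_lt⟩
  have hone : (1 : ZMod p) ∈ Polynomial.nthRootsFinset d (1 : ZMod p) := by
    rw [Polynomial.mem_nthRootsFinset hd, one_pow]
  have hcard : (((Polynomial.nthRootsFinset d (1 : ZMod p)).erase 1).card : ℝ) = d - 1 := by
    rw [Finset.card_erase_of_mem hone, card_nthRootsFinset_zmod hdp, Nat.cast_sub hd]
    simp
  have h1 : ∀ t ∈ (Polynomial.nthRootsFinset d (1 : ZMod p)).erase 1,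
      ∑ n ∈ Finset.Icc 1 (p - 1), ((p : ℝ) - max ((t.val * n % p : ℕ) : ℝ) n) =
        ((p : ℝ) - 1) * (p / 3) +
          ((p : ℝ) - 1) * (1 / 12 + p / ((p : ℝ) - 1) * dedekindSum t.val p) := by
    intro t ht
    obtain ⟨ht1, ht2⟩ := Finset.mem_erase.1 ht
    rw [Polynomial.mem_nthRootsFinset hd] at ht2
    have hval : 2 ≤ t.val := by
      by_contra hcon
      have h01 : t.val = 0 ∨ t.val = 1 := by omega
      rcases h01 with h0 | h0
      · rw [ZMod.val_eq_zero] at h0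
        subst h0
        simp [hd.ne'] at ht2
      · apply ht1
        rw [← ZMod.natCast_zmod_val t, h0, Nat.cast_one]
    have hlt := ZMod.val_lt t
    rw [sum_Icc_max_eq_dedekindSum hprime.pos (by omega)
      (Nat.coprime_of_lt_prime (by omega) hlt hprime).symm
      (Nat.coprime_of_lt_prime (by omega) (by omega) hprime).symm]
    field_simp
    ring
  rw [elmaSum_eq_sum_nthRoots hd hdp hχ, ← Finset.add_sum_erase _ _ hone, Finset.sum_congr rfl h1,
    Finset.sum_add_distrib, ← Finset.mul_sum, ← Finset.mul_sum, Finset.sum_const, nsmul_eq_mul,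
    hcard,
    ZMod.val_one, sum_Icc_max_one hprime.pos]
  generalize ∑ t ∈ (Polynomial.nthRootsFinset d (1 : ZMod p)).erase 1,
    (1 / 12 + p / ((p : ℝ) - 1) * dedekindSum t.val p) = S
  field_simp
  ring

/-! ### The function `γ` -/

theorem totient_le_maxTotient {d k : ℕ} (hd : 0 < d) (hk : k ∣ d) :
    k.totient ≤ maxTotient d :=
  Finset.le_sup (f := Nat.totient) (Nat.mem_divisors.2 ⟨hk, hd.ne'⟩)

theorem maxTotient_pos {d : ℕ} (hd : 0 < d) : 0 < maxTotient d :=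
  totient_le_maxTotient hd (one_dvd d)

theorem maxTotient_le_self (d : ℕ) : maxTotient d ≤ d :=
  Finset.sup_le fun _ hk => (Nat.totient_le _).trans (Nat.divisor_le hk)

theorem maxTotient_le_sub_one {d : ℕ} (hd : 1 < d) : maxTotient d ≤ d - 1 := by
  refine Finset.sup_le fun k hk => ?_
  have hkd := Nat.divisor_le hk
  rcases Nat.lt_or_ge 1 k with h | h
  · have := Nat.totient_lt k h
    omega
  · have := Nat.totient_le k
    omega

theorem maxTotient_prime {d : ℕ} (hd : d.Prime) : maxTotient d = d - 1 := by
  refine le_antisymm (maxTotient_le_sub_one hd.one_lt) ?_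
  rw [← Nat.totient_prime hd]
  exact totient_le_maxTotient hd.pos dvd_rfl

/-! ### The error term -/

theorem abs_dedekindSum_val_le {p d : ℕ} [Fact p.Prime] (hp3 : 3 ≤ p) (hd : Odd d) {t : ZMod p}
    (ht : t ^ d = 1) (ht1 : t ≠ 1) :
    |dedekindSum t.val p| ≤
      10 * Real.log p * (p : ℝ) ^ (1 - 1 / (maxTotient d : ℝ)) := by
  have hp0 : (0 : ℝ) < p := by
    have : (3 : ℝ) ≤ p := by exact_mod_cast hp3
    linarith
  have hγ := maxTotient_pos hd.pos
  have hγ' : (0 : ℝ) < maxTotient d := by exact_mod_cast hγ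
  have hkd : orderOf t ∣ d := orderOf_dvd_of_pow_eq_one ht
  have hkodd : Odd (orderOf t) := hd.of_dvd_nat hkd
  have hk1 : 1 < orderOf t := by
    have h1 : orderOf t ≠ 1 := fun h => ht1 (orderOf_eq_one_iff.1 h)
    have := hkodd.pos
    omega
  have ht0 : t ≠ 0 := by
    rintro rfl
    simp [hd.pos.ne'] at ht
  have hcop : Nat.Coprime t.val p :=
    (Nat.coprime_of_lt_prime (by rwa [Ne, ZMod.val_eq_zero]) (ZMod.val_lt t) Fact.out).symm
  rw [Real.rpow_sub hp0, Real.rpow_one]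
  refine abs_dedekindSum_le (Real.rpow_pos_of_pos hp0 _) hp3 (ZMod.val_lt t) hcop ?_
  intro a b hb hab
  rw [ZMod.natCast_zmod_val] at hab
  have hS : (1 : ℝ) ≤ |(a : ℝ)| + |(b : ℝ)| := by
    have h1 : (1 : ℝ) ≤ |(b : ℝ)| := by exact_mod_cast Int.one_le_abs hb
    linarith [abs_nonneg (a : ℝ)]
  have h1 : (p : ℝ) ≤ (|(a : ℝ)| + |(b : ℝ)|) ^ maxTotient d :=
    (le_pow_totient_of_add_mul_eq_zero hkodd hk1 (IsPrimitiveRoot.orderOf t) hb hab).trans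
      (pow_le_pow_right₀ hS (totient_le_maxTotient hd.pos hkd))
  rw [one_div, Real.rpow_inv_le_iff_of_pos hp0.le (by linarith) hγ', Real.rpow_natCast]
  exact h1

theorem dvd_sub_one_and_three_le {d p : ℕ} (hd : Odd d) (hp : p.Prime)
    (h : p ≡ 1 [MOD 2 * d]) : d ∣ p - 1 ∧ 3 ≤ p := by
  have h1 : 2 * d ∣ p - 1 := (Nat.modEq_iff_dvd' hp.one_le).1 h.symm
  refine ⟨(dvd_mul_left d 2).trans h1, ?_⟩
  have h2 := Nat.le_of_dvd (by have := hp.two_le; omega) h1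
  have := hd.pos
  omega

theorem abs_elmaSum_sub_le {d p : ℕ} (hd : Odd d) (hp : p.Prime) (hmod : p ≡ 1 [MOD 2 * d])
    {χ : DirichletCharacter ℂ p} (hχ : orderOf χ = (p - 1) / d) :
    |elmaSum p χ - (2 * (d : ℝ) + 1) / 6 * (p : ℝ)| ≤
      16 * ((d : ℝ) * Real.log p ^ 2 * (p : ℝ) ^ (1 - 1 / (maxTotient d : ℝ))) := by
  have : Fact p.Prime := ⟨hp⟩
  obtain ⟨hdp, hp3⟩ := dvd_sub_one_and_three_le hd hp hmod
  have hp3' : (3 : ℝ) ≤ p := by exact_mod_cast hp3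
  have hL := one_le_log_natCast hp3
  have hγ : (1 : ℝ) ≤ maxTotient d := by exact_mod_cast maxTotient_pos hd.pos
  have hY : (1 : ℝ) ≤ (p : ℝ) ^ (1 - 1 / (maxTotient d : ℝ)) := by
    apply Real.one_le_rpow (by linarith)
    rw [sub_nonneg]
    exact (div_le_one (by linarith)).2 hγ
  rw [elmaSum_sub_eq hd.pos hdp hχ]
  have hterm : ∀ t ∈ (Polynomial.nthRootsFinset d (1 : ZMod p)).erase 1,
      |1 / 12 + p / ((p : ℝ) - 1) * dedekindSum t.val p| ≤
        16 * (Real.log p ^ 2 * (p : ℝ) ^ (1 - 1 / (maxTotient d : ℝ))) := by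
    intro t ht
    obtain ⟨ht1, ht2⟩ := Finset.mem_erase.1 ht
    rw [Polynomial.mem_nthRootsFinset hd.pos] at ht2
    have hs := abs_dedekindSum_val_le hp3 hd ht2 ht1
    have hfrac : (p : ℝ) / (p - 1) ≤ 3 / 2 := by
      rw [div_le_div_iff₀ (by linarith) (by norm_num)]
      linarith
    have hfrac0 : 0 ≤ (p : ℝ) / (p - 1) := div_nonneg (by linarith) (by linarith)
    generalize (p : ℝ) ^ (1 - 1 / (maxTotient d : ℝ)) = Y at *
    generalize Real.log p = L at *
    have hLY : 1 ≤ L * Y := by nlinarith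
    have hLLY : L * Y ≤ L ^ 2 * Y := by nlinarith
    calc |1 / 12 + p / ((p : ℝ) - 1) * dedekindSum t.val p|
        ≤ |(1 / 12 : ℝ)| + |p / ((p : ℝ) - 1) * dedekindSum t.val p| := abs_add_le _ _
      _ = 1 / 12 + p / ((p : ℝ) - 1) * |dedekindSum t.val p| := by
          rw [abs_mul, abs_of_nonneg hfrac0, abs_of_pos (by norm_num : (0 : ℝ) < 1 / 12)]
      _ ≤ 1 / 12 + 3 / 2 * (10 * L * Y) := by gcongr
      _ ≤ 16 * (L ^ 2 * Y) := by linarith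
  have hcard : (((Polynomial.nthRootsFinset d (1 : ZMod p)).erase 1).card : ℝ) ≤ d := by
    have h1 := Finset.card_erase_le (s := Polynomial.nthRootsFinset d (1 : ZMod p)) (a := 1)
    rw [card_nthRootsFinset_zmod hdp] at h1
    exact_mod_cast h1
  calc |∑ t ∈ (Polynomial.nthRootsFinset d (1 : ZMod p)).erase 1,
        (1 / 12 + p / ((p : ℝ) - 1) * dedekindSum t.val p)|
      ≤ ∑ t ∈ (Polynomial.nthRootsFinset d (1 : ZMod p)).erase 1,
        |1 / 12 + p / ((p : ℝ) - 1) * dedekindSum t.val p| := Finset.abs_sum_le_sum_abs _ _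
    _ ≤ (((Polynomial.nthRootsFinset d (1 : ZMod p)).erase 1).card : ℝ) *
        (16 * (Real.log p ^ 2 * (p : ℝ) ^ (1 - 1 / (maxTotient d : ℝ)))) := by
        rw [← nsmul_eq_mul]
        exact Finset.sum_le_card_nsmul _ _ _ hterm
    _ ≤ (d : ℝ) * (16 * (Real.log p ^ 2 * (p : ℝ) ^ (1 - 1 / (maxTotient d : ℝ)))) := by
        gcongr
    _ = _ := by ring

/-- In the range `d ≤ c log p / log log p` the saving `p ^ (-1 / γ(d))` is at least a power
`(log p) ^ (-1 / c)`, as `γ(d) ≤ d`. It beats the factor `(log p) ^ 2` because `c < 1 / 2`. -/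
theorem abs_elmaSum_div_sub_one_le {d p : ℕ} (hd : Odd d) (hp : p.Prime)
    (hmod : p ≡ 1 [MOD 2 * d]) {c : ℝ} (hc : 0 < c) (hlog : 0 < Real.log (Real.log p))
    (hdc : (d : ℝ) ≤ c * (Real.log p / Real.log (Real.log p)))
    {χ : DirichletCharacter ℂ p} (hχ : orderOf χ = (p - 1) / d) :
    |elmaSum p χ / ((2 * (d : ℝ) + 1) / 6 * (p : ℝ)) - 1| ≤
      48 * Real.log p ^ (-(1 / c - 2)) := by
  obtain ⟨-, hp3⟩ := dvd_sub_one_and_three_le hd hp hmod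
  have hp0 : (0 : ℝ) < p := by exact_mod_cast hp.pos
  have hL : 0 < Real.log p := by linarith [one_le_log_natCast hp3]
  have hd1 : (1 : ℝ) ≤ d := by exact_mod_cast hd.pos
  have hγ : (1 : ℝ) ≤ maxTotient d := by exact_mod_cast maxTotient_pos hd.pos
  have hγd : (maxTotient d : ℝ) ≤ d := by exact_mod_cast maxTotient_le_self d
  have hM : 0 < (2 * (d : ℝ) + 1) / 6 * p := by positivity
  have hbound := abs_elmaSum_sub_le hd hp hmod hχ
  have hsave : (p : ℝ) ^ (-(1 / (maxTotient d : ℝ))) ≤ Real.log p ^ (-(1 / c)) := by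
    rw [Real.rpow_def_of_pos hp0, Real.rpow_def_of_pos hL, Real.exp_le_exp]
    have h1 : (maxTotient d : ℝ) * Real.log (Real.log p) ≤ c * Real.log p := by
      have h2 := mul_le_mul_of_nonneg_right (hγd.trans hdc) hlog.le
      rwa [mul_assoc, div_mul_cancel₀ _ hlog.ne'] at h2
    have h2 : Real.log (Real.log p) / c ≤ Real.log p / maxTotient d := by
      rw [div_le_div_iff₀ hc (by linarith)]
      linarith
    have h3 : Real.log (Real.log p) * -(1 / c) = -(Real.log (Real.log p) / c) := by ring
    have h4 : Real.log p * -(1 / (maxTotient d : ℝ)) = -(Real.log p / maxTotient d) := by ring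
    rw [h3, h4]
    linarith
  have hsplit : (p : ℝ) ^ (1 - 1 / (maxTotient d : ℝ)) =
      p * (p : ℝ) ^ (-(1 / (maxTotient d : ℝ))) := by
    rw [sub_eq_add_neg, Real.rpow_add hp0, Real.rpow_one]
  have hL2 : Real.log p ^ (-(1 / c - 2)) = Real.log p ^ 2 * Real.log p ^ (-(1 / c)) := by
    rw [show -(1 / c - 2) = (2 : ℕ) + -(1 / c) by push_cast; ring, Real.rpow_add hL,
      Real.rpow_natCast]
  rw [div_sub_one hM.ne', abs_div, abs_of_pos hM, div_le_iff₀ hM]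
  refine hbound.trans ?_
  rw [hsplit, hL2]
  calc 16 * ((d : ℝ) * Real.log p ^ 2 * (p * (p : ℝ) ^ (-(1 / (maxTotient d : ℝ)))))
      ≤ 16 * ((d : ℝ) * Real.log p ^ 2 * (p * Real.log p ^ (-(1 / c)))) := by gcongr
    _ = 48 * (Real.log p ^ 2 * Real.log p ^ (-(1 / c))) * (2 * d / 6 * p) := by ring
    _ ≤ 48 * (Real.log p ^ 2 * Real.log p ^ (-(1 / c))) * ((2 * d + 1) / 6 * p) := by
        gcongr
        linarith

theorem theorem4p2 :
    -- the size of `γ(d)`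
    (∀ d : ℕ, Odd d → 1 < d → maxTotient d ≤ d - 1) ∧
    (∀ d : ℕ, Odd d → d.Prime → maxTotient d = d - 1) ∧
    -- the asymptotic formula, with an absolute implied constant
    (∃ C : ℝ, 0 < C ∧ ∀ d p : ℕ, Odd d → p.Prime → p ≡ 1 [MOD 2 * d] →
      ∀ χ : DirichletCharacter ℂ p, orderOf χ = (p - 1) / d →
        |elmaSum p χ - (2 * (d : ℝ) + 1) / 6 * (p : ℝ)| ≤
          C * ((d : ℝ) * Real.log p ^ 2 * (p : ℝ) ^ (1 - 1 / (maxTotient d : ℝ)))) ∧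
    -- asymptotic equivalence as `p → ∞`, uniformly for `d ≤ c log p / log log p`
    (∀ c : ℝ, c < 1 / 2 → ∀ ε : ℝ, 0 < ε → ∃ P : ℕ, ∀ d p : ℕ, P ≤ p →
      Odd d → p.Prime → p ≡ 1 [MOD 2 * d] →
      (d : ℝ) ≤ c * (Real.log p / Real.log (Real.log p)) →
      ∀ χ : DirichletCharacter ℂ p, orderOf χ = (p - 1) / d →
        |elmaSum p χ / ((2 * (d : ℝ) + 1) / 6 * (p : ℝ)) - 1| ≤ ε) := by
  refine ⟨fun d _ hd => maxTotient_le_sub_one hd, fun d _ hd => maxTotient_prime hd,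
    ⟨16, by norm_num, fun d p hd hp hmod χ hχ => abs_elmaSum_sub_le hd hp hmod hχ⟩, ?_⟩
  intro c hc ε hε
  have hlogT : Filter.Tendsto (fun p : ℕ => Real.log (p : ℝ)) Filter.atTop Filter.atTop :=
    Real.tendsto_log_atTop.comp tendsto_natCast_atTop_atTop
  have hloglog : ∀ᶠ p : ℕ in Filter.atTop, 0 < Real.log (Real.log (p : ℝ)) :=
    (Real.tendsto_log_atTop.comp hlogT).eventually_gt_atTop 0
  rcases le_or_gt c 0 with hc0 | hc0
  · -- for `c ≤ 0` no `d ≥ 1` is admissible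
    obtain ⟨P, hP⟩ := Filter.eventually_atTop.1 hloglog
    refine ⟨P, fun d p hPp hd hp hmod hdc χ hχ => ?_⟩
    have hd1 : (1 : ℝ) ≤ d := by exact_mod_cast hd.pos
    have hL := one_le_log_natCast (dvd_sub_one_and_three_le hd hp hmod).2
    have h1 : 0 ≤ Real.log p / Real.log (Real.log p) :=
      div_nonneg (by linarith) (hP p hPp).le
    have h2 := mul_nonpos_of_nonpos_of_nonneg hc0 h1
    linarith
  · have hexp : 0 < 1 / c - 2 := by
      rw [sub_pos, lt_div_iff₀ hc0]
      linarith
    have hlim : Filter.Tendsto (fun p : ℕ => 48 * Real.log (p : ℝ) ^ (-(1 / c - 2)))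
        Filter.atTop (nhds 0) := by
      simpa using ((tendsto_rpow_neg_atTop hexp).comp hlogT).const_mul 48
    obtain ⟨P, hP⟩ := Filter.eventually_atTop.1 (hloglog.and (hlim.eventually_le_const hε))
    exact ⟨P, fun d p hPp hd hp hmod hdc χ hχ =>
      (abs_elmaSum_div_sub_one_le hd hp hmod hc0 (hP p hPp).1 hdc hχ).trans (hP p hPp).2⟩
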